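/- Consider the $K$-armed adversarial bandit game over $T$ rounds. A loss sequence is a family $\ell_{1:T} = (\ell_{i,t})_{1\le i\le K,\,1\le t\le T}$ with values in $[0,1]$, fixed in advance; put $\ell_t = (\ell_{i,t})_{1\le i\le K}$. In each round $t$ a randomised bandit algorithm picks an action $I_t \in \{1,\dots,K\}$ from its internal randomness and its past observations $(I_s, \ell_{I_s,s})_{s<t}$, and then observes only its own loss $\ell_{I_t,t}$. Its regret is $$R_T(\ell_{1:T}) = \sum_{t=1}^T \ell_{I_t,t} - \min_{1\le i\le K} \sum_{t=1}^T \ell_{i,t}.$$ For $\rho \ge 0$ let $\mathcal{C}_\rho = \{x \in [0,1]^K : \max_{i,j}|x_i - x_j| \le \rho\}$. Let $K \ge 2$, $T \ge 32(K-1)\log(14)$ and $\rho \ge 0.22\sqrt{(K-1)/T}$. Then for every randomised bandit algorithm there are $\ell_1,\dots,\ell_T \in \mathcal{C}_\rho$ with $$\mathbb{E}[R_T(\ell_{1:T})] \ge \frac{\sqrt{T(K-1)}}{504},$$ where the expectation is with respect to the internal randomness of the algorithm. In particular, $$\sup_{\ell_1,\dots,\ell_T \in \mathcal{C}_\rho}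 \mathbb{E}[R_T(\ell_{1:T})] \ge \frac{\sqrt{T(K-1)}}{504}.$$ -/

import Mathlib

open MeasureTheory

/-- A randomised algorithm for the `K`-armed bandit game with `T` rounds (indexed by `Fin T`).
All of its internal randomness, including the draw of each action from the distribution that the
algorithm has chosen, is carried by an outcome `ω : Ω` of an auxiliary probability space. In round
`t` it picks `act t ω h`, where the history `h` lists the earlier actions together with the losses
of those actions; the other coordinates of the loss vectors are never seen. -/
structure BanditAlgorithm (K T : ℕ) (Ω : Type*) [MeasurableSpace Ω] where
  act : (t : Fin T) → Ω → (Fin t → Fin K × ℝ) → Fin K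
  measurable_act : ∀ t : Fin T,
    Measurable (fun x : Ω × (Fin t → Fin K × ℝ) => act t x.1 x.2)

namespace BanditAlgorithm

variable {K T : ℕ} {Ω : Type*} [MeasurableSpace Ω]

/-- The action `I_t` that is played in round `t` against the losses `ℓ` (`ℓ t i` is the loss of
arm `i` in round `t`): the algorithm is fed with the history `(I_s, ℓ_{I_s, s})`, `s < t`. -/
def action (A : BanditAlgorithm K T Ω) (ℓ : Fin T → Fin K → ℝ) (ω : Ω) (t : Fin T) : Fin K :=
  A.act t ω (fun s =>
    (A.action ℓ ω ⟨s, s.isLt.trans t.isLt⟩,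
      ℓ ⟨s, s.isLt.trans t.isLt⟩ (A.action ℓ ω ⟨s, s.isLt.trans t.isLt⟩)))
termination_by t.val
decreasing_by all_goals exact s.isLt

/-- The regret `R_T = ∑ₜ ℓ_{I_t, t} - minᵢ ∑ₜ ℓ_{i, t}`. -/
noncomputable def regret (A : BanditAlgorithm K T Ω) (ℓ : Fin T → Fin K → ℝ) (ω : Ω) : ℝ :=
  ∑ t, ℓ t (A.action ℓ ω t) - ⨅ i, ∑ t, ℓ t i

/-- The expected regret on the fixed loss sequence `ℓ`; the expectation is over the internal
randomness of the algorithm, whose law is `P`. -/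
noncomputable def expectedRegret (A : BanditAlgorithm K T Ω) (P : Measure Ω)
    (ℓ : Fin T → Fin K → ℝ) : ℝ :=
  ∫ ω, A.regret ℓ ω ∂P

end BanditAlgorithm

/-- The loss vectors in `[0,1]^K` with effective range at most `ρ`. -/
def lossesOfRange (K : ℕ) (ρ : ℝ) : Set (Fin K → ℝ) :=
  {x | (∀ i, x i ∈ Set.Icc (0 : ℝ) 1) ∧ ∀ i j, |x i - x j| ≤ ρ}

/-! The learner sees one arm per round, so it perceives only the marginal laws of the losses, while
the effective range depends on their coupling. In each round draw `k` uniformly from `0, ..., N -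
1`. Every arm suffers `k / N`, except that a hidden arm `j` drops to `(k - 1) / N` with conditional
probability `k (N - k) / N ^ 2`. Losses within a round differ by at most `1 / N`. The mean advantage
of `j` is of order `1 / N`, yet one observation of `j` carries relative entropy only of order `1 / N
^ 2` (`sum_stepLaw_mul_sub`, `relEntropy_tiltedLaw_le`).

The environment with hidden arm `j` is compared with the one in which all arms share the uniform
loss (`sum_prod_mul_coupledLosses_ge`). There the expected play counts sum to `T`, so on average
over `j` the relative entropy of the whole game is of order `T / (K N ^ 2)`. With `N` of order `√(T
/ (K - 1))` the hidden arm remains undetected, and the regret is of order `T / N`, that is `√(T (K -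
1))` (`sum_sum_prod_mul_excess_ge`, `exists_grid`).

For each fixed outcome `ω` the algorithm is deterministic and all averages are finite sums.
Integrating over `ω` last yields one fixed loss sequence (`exists_le_expectedRegret`). -/

/-- An action map is nonanticipating if the action of each round is determined by the losses of the
actions played in the earlier rounds. -/
def IsNonanticipating {K T : ℕ} (I : (Fin T → Fin K → ℝ) → Fin T → Fin K) : Prop :=
  ∀ ℓ ℓ' t, (∀ s < t, ℓ s (I ℓ s) = ℓ' s (I ℓ s)) → I ℓ t = I ℓ' t

namespace BanditAlgorithm

variable {K T : ℕ} {Ω : Type*} [MeasurableSpace Ω]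

theorem isNonanticipating_action (A : BanditAlgorithm K T Ω) (ω : Ω) :
    IsNonanticipating (fun ℓ => A.action ℓ ω) := by
  intro ℓ ℓ' t
  obtain ⟨n, hn⟩ := t
  induction n using Nat.strong_induction_on with
  | _ n ih =>
    intro h
    have key : ∀ s : Fin n, A.action ℓ ω ⟨s, s.isLt.trans hn⟩ =
        A.action ℓ' ω ⟨s, s.isLt.trans hn⟩ := fun s =>
      ih s s.isLt _ fun r hr => h r (lt_trans hr (Fin.mk_lt_mk.2 s.isLt))
    change A.action ℓ ω ⟨n, hn⟩ = A.action ℓ' ω ⟨n, hn⟩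
    rw [action, action]
    congr 1
    funext s
    have hs := h ⟨s, s.isLt.trans hn⟩ (Fin.mk_lt_mk.2 s.isLt)
    simp only at hs
    rw [← key s, hs]

theorem measurable_action (A : BanditAlgorithm K T Ω) (ℓ : Fin T → Fin K → ℝ) (t : Fin T) :
    Measurable fun ω => A.action ℓ ω t := by
  obtain ⟨n, hn⟩ := t
  induction n using Nat.strong_induction_on with
  | _ n ih =>
    have h : (fun ω => A.action ℓ ω ⟨n, hn⟩) = fun ω => A.act ⟨n, hn⟩ ω (fun s =>
        (A.action ℓ ω ⟨s, s.isLt.trans hn⟩,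
          ℓ ⟨s, s.isLt.trans hn⟩ (A.action ℓ ω ⟨s, s.isLt.trans hn⟩))) := by
      funext ω
      rw [action]
    rw [h]
    refine (A.measurable_act ⟨n, hn⟩).comp (measurable_id.prodMk (measurable_pi_lambda _ ?_))
    intro s
    have hs := ih s s.isLt (s.isLt.trans hn)
    exact hs.prodMk ((measurable_of_finite _).comp hs)

theorem measurable_regret (A : BanditAlgorithm K T Ω) (ℓ : Fin T → Fin K → ℝ) :
    Measurable (A.regret ℓ) := by
  unfold regret
  refine Measurable.sub_const (Finset.measurable_sum _ fun t _ => ?_) _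
  exact (measurable_of_finite (ℓ t)).comp (A.measurable_action ℓ t)

theorem abs_regret_le (A : BanditAlgorithm K T Ω) {ℓ : Fin T → Fin K → ℝ}
    (hℓ : ∀ t i, ℓ t i ∈ Set.Icc (0 : ℝ) 1) (hK : 0 < K) (ω : Ω) : |A.regret ℓ ω| ≤ T := by
  have : Nonempty (Fin K) := ⟨⟨0, hK⟩⟩
  have sum_mem : ∀ a : Fin T → Fin K, 0 ≤ ∑ t, ℓ t (a t) ∧ ∑ t, ℓ t (a t) ≤ T := fun a => by
    refine ⟨Finset.sum_nonneg fun t _ => (hℓ t _).1, ?_⟩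
    calc ∑ t, ℓ t (a t) ≤ ∑ _t : Fin T, (1 : ℝ) := Finset.sum_le_sum fun t _ => (hℓ t _).2
      _ = T := by simp
  obtain ⟨i, hi⟩ := exists_eq_ciInf_of_finite (f := fun i => ∑ t, ℓ t i)
  have h1 := sum_mem (A.action ℓ ω)
  have h2 := sum_mem fun _ => i
  unfold regret
  rw [← hi, abs_le]
  constructor <;> linarith

theorem integrable_regret (A : BanditAlgorithm K T Ω) (P : Measure Ω) [IsProbabilityMeasure P]
    {ℓ : Fin T → Fin K → ℝ} (hℓ : ∀ t i, ℓ t i ∈ Set.Icc (0 : ℝ) 1) (hK : 0 < K) :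
    Integrable (A.regret ℓ) P :=
  Integrable.of_bound (A.measurable_regret ℓ).aestronglyMeasurable (T : ℝ)
    (Filter.Eventually.of_forall fun ω => A.abs_regret_le hℓ hK ω)

theorem expectedRegret_le (A : BanditAlgorithm K T Ω) (P : Measure Ω) [IsProbabilityMeasure P]
    {ℓ : Fin T → Fin K → ℝ} (hℓ : ∀ t i, ℓ t i ∈ Set.Icc (0 : ℝ) 1) (hK : 0 < K) :
    A.expectedRegret P ℓ ≤ T := by
  calc A.expectedRegret P ℓ ≤ ∫ _ω, (T : ℝ) ∂P :=
        integral_mono (A.integrable_regret P hℓ hK) (integrable_const _)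
          fun ω => (abs_le.1 (A.abs_regret_le hℓ hK ω)).2
    _ = T := by simp

/-- A bound on a convex combination of regrets that holds for each outcome is attained in
expectation by one of the loss sequences. -/
theorem exists_le_expectedRegret (A : BanditAlgorithm K T Ω) (P : Measure Ω)
    [IsProbabilityMeasure P] {ι : Type*} [Fintype ι] {m : ι → ℝ} (hm : ∀ i, 0 ≤ m i)
    (hm1 : ∑ i, m i = 1) {ℓ : ι → Fin T → Fin K → ℝ}
    (hℓ : ∀ i t k, ℓ i t k ∈ Set.Icc (0 : ℝ) 1) (hK : 0 < K) {c : ℝ}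
    (h : ∀ ω, c ≤ ∑ i, m i * A.regret (ℓ i) ω) : ∃ i, c ≤ A.expectedRegret P (ℓ i) := by
  have : Nonempty ι := by
    by_contra hne
    rw [not_nonempty_iff] at hne
    simp at hm1
  obtain ⟨i₀, hi₀⟩ := Finite.exists_max fun i => A.expectedRegret P (ℓ i)
  refine ⟨i₀, ?_⟩
  have hint : ∀ i, Integrable (fun ω => m i * A.regret (ℓ i) ω) P := fun i =>
    (A.integrable_regret P (hℓ i) hK).const_mul _
  calc c = ∫ _ω, c ∂P := by simp
    _ ≤ ∫ ω, ∑ i, m i * A.regret (ℓ i) ω ∂P :=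
        integral_mono (integrable_const _) (integrable_finsetSum _ fun i _ => hint i) h
    _ = ∑ i, m i * A.expectedRegret P (ℓ i) := by
        rw [integral_finsetSum _ fun i _ => hint i]
        simp only [integral_const_mul, expectedRegret]
    _ ≤ ∑ i, m i * A.expectedRegret P (ℓ i₀) :=
        Finset.sum_le_sum fun i _ => mul_le_mul_of_nonneg_left (hi₀ i) (hm i)
    _ = A.expectedRegret P (ℓ i₀) := by rw [← Finset.sum_mul, hm1, one_mul]

end BanditAlgorithm

/-! ### Finite product weights. -/

theorem mul_prod_update {ι α : Type*} [Fintype ι] [DecidableEq ι] (μ : α → ℝ) (t : ι) (w : ι → α)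
    (v : α) : μ (w t) * ∏ s, μ (Function.update w t v s) = μ v * ∏ s, μ (w s) := by
  rw [← Finset.mul_prod_erase _ _ (Finset.mem_univ t),
    ← Finset.mul_prod_erase _ (fun s => μ (w s)) (Finset.mem_univ t), Function.update_self]
  rw [Finset.prod_congr rfl (g := fun s => μ (w s)) fun s hs => by
    rw [Function.update_of_ne (Finset.ne_of_mem_erase hs)]]
  ring

/-- Under a product weight, a function of one coordinate is independent of a function of the
others. -/
theorem sum_prod_mul_of_update_eq {ι α : Type*} [Fintype ι] [DecidableEq ι] [Fintype α]
    {μ : α → ℝ} (hμ : ∑ v, μ v = 1) (t : ι) {f : (ι → α) → ℝ}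
    (hf : ∀ w v, f (Function.update w t v) = f w) (g : α → ℝ) :
    ∑ w : ι → α, (∏ s, μ (w s)) * (f w * g (w t)) =
      (∑ v, μ v * g v) * ∑ w : ι → α, (∏ s, μ (w s)) * f w := by
  -- Adjoin an independent sample of the law `μ` and swap it with coordinate `t`; the joint weight
  -- is invariant.
  have e : Function.Involutive
      fun x : α × (ι → α) => (x.2 t, Function.update x.2 t x.1) := fun x => by
    ext <;> simp
  calc ∑ w : ι → α, (∏ s, μ (w s)) * (f w * g (w t))
      = ∑ x : α × (ι → α), μ x.1 * ((∏ s, μ (x.2 s)) * (f x.2 * g (x.2 t))) := by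
        rw [Fintype.sum_prod_type]
        simp only [← Finset.mul_sum]
        rw [← Finset.sum_mul, hμ, one_mul]
    _ = ∑ x : α × (ι → α), μ x.1 * g x.1 * ((∏ s, μ (x.2 s)) * f x.2) := by
        refine Fintype.sum_equiv e.toPerm _ _ fun x => ?_
        have := mul_prod_update μ t x.2 x.1
        simp only [Function.Involutive.coe_toPerm, hf]
        linear_combination (-(f x.2 * g (x.2 t))) * this
    _ = _ := by
        rw [Fintype.sum_prod_type, Finset.sum_mul]
        simp only [← Finset.mul_sum]

theorem sum_prod_eq_one {ι α : Type*} [Fintype ι] [DecidableEq ι] [Fintype α] {μ : α → ℝ}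
    (hμ : ∑ v, μ v = 1) : ∑ w : ι → α, ∏ s, μ (w s) = 1 := by
  rw [← Fintype.piFinset_univ, ← Finset.prod_univ_sum]
  simp [hμ]

/-! ### Pinsker's inequality. -/

/-- This follows from `log (1 + y) ≥ 2 y / (y + 2)` at `y = (1 - x) / x`. -/
theorem sq_half_le_sub_one_sub_log {x : ℝ} (hx : 0 < x) (hx1 : x ≤ 1) :
    (1 - x) ^ 2 / 2 ≤ x - 1 - Real.log x := by
  have h := Real.le_log_one_add_of_nonneg (x := (1 - x) / x) (by apply div_nonneg <;> linarith)
  have e1 : 1 + (1 - x) / x = x⁻¹ := by field_simp; ring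
  have e2 : 2 * ((1 - x) / x) / ((1 - x) / x + 2) = 2 * (1 - x) / (1 + x) := by
    have : (1 - x) + 2 * x ≠ 0 := by linarith
    field_simp
    ring
  rw [e1, Real.log_inv, e2] at h
  have h3 : (1 - x) ^ 2 / 2 + (1 - x) ≤ 2 * (1 - x) / (1 + x) := by
    rw [le_div_iff₀ (by linarith)]
    nlinarith [pow_nonneg (sub_nonneg.2 hx1) 3]
  linarith

/-- A pointwise form of Pinsker's inequality. -/
theorem one_sub_le_of_pos {x c : ℝ} (hx : 0 < x) (hc : 0 < c) :
    max (1 - x) 0 ≤ c / 2 + (x - 1 - Real.log x) / c := by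
  have h0 : 0 ≤ x - 1 - Real.log x := by linarith [Real.log_le_sub_one_of_pos hx]
  refine max_le ?_ (by positivity)
  rcases le_total x 1 with h | h
  · have := sq_half_le_sub_one_sub_log hx h
    have h2 : (1 - x) ^ 2 / 2 / c ≤ (x - 1 - Real.log x) / c := by gcongr
    have h3 : 1 - x ≤ c / 2 + (1 - x) ^ 2 / 2 / c := by
      have : c / 2 + (1 - x) ^ 2 / 2 / c - (1 - x) = (c - (1 - x)) ^ 2 / 2 / c := by
        field_simp; ring
      have : 0 ≤ (c - (1 - x)) ^ 2 / 2 / c := by positivity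
      linarith
    linarith
  · have : 0 ≤ c / 2 + (x - 1 - Real.log x) / c := by positivity
    linarith

/-! ### Change of measure for coupled losses. -/

section SharedNoise

variable {K T : ℕ} {V W : Type*}

/-- All arms suffer the same loss. -/
def commonLosses (K : ℕ) (x : V → ℝ) (z : Fin T → V) : Fin T → Fin K → ℝ :=
  fun t _ => x (z t)

/-- Arm `j` suffers the loss encoded by `Y`, all other arms the one encoded by `X`. -/
def coupledLosses (x : V → ℝ) (X Y : W → V) (j : Fin K) (w : Fin T → W) :
    Fin T → Fin K → ℝ :=
  fun t i => x (if i = j then Y (w t) else X (w t))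

theorem IsNonanticipating.update_common {I : (Fin T → Fin K → ℝ) → Fin T → Fin K}
    (hI : IsNonanticipating I) (x : V → ℝ) (t : Fin T) (z : Fin T → V) (v : V) :
    I (commonLosses K x (Function.update z t v)) t = I (commonLosses K x z) t :=
  (hI _ _ t fun s hs => by simp [commonLosses, Function.update_of_ne hs.ne]).symm

theorem IsNonanticipating.update_coupled {I : (Fin T → Fin K → ℝ) → Fin T → Fin K}
    (hI : IsNonanticipating I) (x : V → ℝ) (X Y : W → V) (j : Fin K) (t : Fin T) (w : Fin T → W)
    (v : W) :
    I (coupledLosses x X Y j (Function.update w t v)) t = I (coupledLosses x X Y j w) t :=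
  (hI _ _ t fun s hs => by simp [coupledLosses, Function.update_of_ne hs.ne]).symm

variable [Fintype V] [Fintype W]

/-- The law of the observations when `j` is the distinguished arm, expressed through the actions
played against common losses. -/
theorem sum_prod_mul_coupledLosses [DecidableEq V]
    {I : (Fin T → Fin K → ℝ) → Fin T → Fin K}
    (hI : IsNonanticipating I) (x : V → ℝ) {X Y : W → V} {r : W → ℝ} {p q : V → ℝ}
    (hX : ∀ v, (∑ w, if X w = v then r w else 0) = p v)
    (hY : ∀ v, (∑ w, if Y w = v then r w else 0) = q v) (j : Fin K)
    (f : (Fin T → Fin K) → ℝ) :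
    ∑ w : Fin T → W, (∏ t, r (w t)) * f (I (coupledLosses x X Y j w)) =
      ∑ z : Fin T → V, (∏ t, if I (commonLosses K x z) t = j then q (z t) else p (z t)) *
        f (I (commonLosses K x z)) := by
  classical
  -- Along a given path `z` each round reveals either `X` or `Y`, never both, so their coupling
  -- disappears from the weight.
  have marginal : ∀ z : Fin T → V,
      (∏ t, if I (commonLosses K x z) t = j then q (z t) else p (z t)) =
        ∑ w : Fin T → W, ∏ t, if (if I (commonLosses K x z) t = j then Y (w t) else X (w t)) = z t
          then r (w t) else 0 := fun z => by
    rw [← Fintype.piFinset_univ, ← Finset.prod_univ_sum (fun _ => Finset.univ)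
      (fun t w => if (if I (commonLosses K x z) t = j then Y w else X w) = z t then r w else 0)]
    refine Finset.prod_congr rfl fun t _ => ?_
    split_ifs
    · exact (hY _).symm
    · exact (hX _).symm
  simp only [marginal, Finset.sum_mul]
  rw [Finset.sum_comm]
  refine Finset.sum_congr rfl fun w _ => ?_
  generalize ha : I (coupledLosses x X Y j w) = a
  -- The path of observations under `w`: fed as common losses, it triggers the same actions, and it
  -- is the only path consistent with `w`.
  set z₀ : Fin T → V := fun t => if a t = j then Y (w t) else X (w t) with hz₀
  have haz : I (commonLosses K x z₀) = a := by
    funext t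
    rw [← ha]
    exact (hI (coupledLosses x X Y j w) _ t fun s _ => by
      rw [ha]
      rfl).symm
  rw [Finset.sum_eq_single z₀]
  · simp only [haz]
    congr 1
    exact Finset.prod_congr rfl fun t _ => by rw [if_pos rfl]
  · intro z _ hz
    by_cases h : ∀ t, (if I (commonLosses K x z) t = j then Y (w t) else X (w t)) = z t
    · refine absurd ?_ hz
      have e : I (commonLosses K x z) = a := by
        rw [← ha]
        funext t
        refine hI _ (coupledLosses x X Y j w) t fun s _ => ?_
        change x (z s) = x (if I (commonLosses K x z) s = j then Y (w s) else X (w s))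
        rw [h s]
      funext t
      rw [← h t, e]
    · push Not at h
      obtain ⟨t, ht⟩ := h
      rw [Finset.prod_eq_zero (Finset.mem_univ t) (if_neg ht), zero_mul]
  · simp

/-- The expected number of rounds in which arm `j` is played against independent common losses of
law `p`. -/
noncomputable def commonCount (I : (Fin T → Fin K → ℝ) → Fin T → Fin K) (x : V → ℝ) (p : V → ℝ)
    (j : Fin K) : ℝ :=
  ∑ t, ∑ z : Fin T → V, (∏ s, p (z s)) * if I (commonLosses K x z) t = j then 1 else 0

theorem sum_commonCount (I : (Fin T → Fin K → ℝ) → Fin T → Fin K) (x : V → ℝ) {p : V → ℝ}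
    (hp1 : ∑ v, p v = 1) : ∑ j, commonCount I x p j = T := by
  unfold commonCount
  rw [Finset.sum_comm]
  have : ∀ t : Fin T, ∑ j : Fin K, ∑ z : Fin T → V,
      (∏ s, p (z s)) * (if I (commonLosses K x z) t = j then (1 : ℝ) else 0) = 1 := fun t => by
    rw [Finset.sum_comm]
    simp [sum_prod_eq_one hp1]
  rw [Finset.sum_congr rfl fun t _ => this t]
  simp

/-- The mean log-likelihood ratio of the observations is the expected number of plays of the
distinguished arm times that of one observation. -/
theorem sum_prod_mul_log {I : (Fin T → Fin K → ℝ) → Fin T → Fin K}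
    (hI : IsNonanticipating I) (x : V → ℝ) {p l : V → ℝ} (hp1 : ∑ v, p v = 1)
    (hl : ∀ v, l v ≠ 0) (j : Fin K) :
    ∑ z : Fin T → V, (∏ s, p (z s)) *
        Real.log (∏ t, if I (commonLosses K x z) t = j then l (z t) else 1) =
      (∑ v, p v * Real.log (l v)) * commonCount I x p j := by
  have h : ∀ z : Fin T → V, Real.log (∏ t, if I (commonLosses K x z) t = j then l (z t) else 1) =
      ∑ t, (if I (commonLosses K x z) t = j then 1 else 0) * Real.log (l (z t)) := fun z => by
    rw [Real.log_prod fun t _ => by split_ifs <;> simp [hl]]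
    refine Finset.sum_congr rfl fun t _ => ?_
    split_ifs <;> simp
  simp only [h, Finset.mul_sum]
  rw [Finset.sum_comm, commonCount, Finset.mul_sum]
  refine Finset.sum_congr rfl fun t _ => ?_
  -- Whether `j` is played in round `t` depends only on earlier rounds, hence is independent of `z
  -- t`, as in Wald's identity.
  exact sum_prod_mul_of_update_eq hp1 t
    (f := fun z => if I (commonLosses K x z) t = j then 1 else 0)
    (fun z v => by simp only [hI.update_common]) fun v => Real.log (l v)

/-- Change of measure from common losses to losses with a distinguished arm. -/
theorem sum_prod_mul_coupledLosses_ge [DecidableEq V]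
    {I : (Fin T → Fin K → ℝ) → Fin T → Fin K} (hI : IsNonanticipating I) (x : V → ℝ)
    {X Y : W → V} {r : W → ℝ} {p q : V → ℝ}
    (hX : ∀ v, (∑ w, if X w = v then r w else 0) = p v)
    (hY : ∀ v, (∑ w, if Y w = v then r w else 0) = q v) (j : Fin K)
    (hp : ∀ v, 0 < p v) (hq : ∀ v, 0 < q v) (hp1 : ∑ v, p v = 1) (hr1 : ∑ w, r w = 1)
    {c κ : ℝ} (hc : 0 < c) (hκ : -∑ v, p v * Real.log (q v / p v) ≤ κ)
    {f : (Fin T → Fin K) → ℝ} (hf : ∀ a, f a ∈ Set.Icc (0 : ℝ) 1) :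
    ∑ z : Fin T → V, (∏ s, p (z s)) * f (I (commonLosses K x z)) -
        (c / 2 + κ * commonCount I x p j / c) ≤
      ∑ w : Fin T → W, (∏ t, r (w t)) * f (I (coupledLosses x X Y j w)) := by
  set L : (Fin T → V) → ℝ := fun z =>
    ∏ t, if I (commonLosses K x z) t = j then q (z t) / p (z t) else 1 with hL
  have hLpos : ∀ z, 0 < L z := fun z =>
    Finset.prod_pos fun t _ => by split_ifs; exacts [div_pos (hq _) (hp _), one_pos]
  have hP : ∀ z : Fin T → V, 0 ≤ ∏ s, p (z s) := fun z => Finset.prod_nonneg fun s _ => (hp _).le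
  have density : ∀ z : Fin T → V,
      (∏ t, if I (commonLosses K x z) t = j then q (z t) else p (z t)) =
        (∏ s, p (z s)) * L z := fun z => by
    rw [hL, ← Finset.prod_mul_distrib]
    refine Finset.prod_congr rfl fun t _ => ?_
    have := (hp (z t)).ne'
    split_ifs
    · field_simp
    · ring
  have change := fun f => sum_prod_mul_coupledLosses hI x hX hY j f
  simp only [density] at change
  have hL1 : ∑ z : Fin T → V, (∏ s, p (z s)) * L z = 1 := by
    have := change fun _ => 1
    simp only [mul_one] at this
    rw [← this, sum_prod_eq_one hr1]
  have hlog : -∑ z : Fin T → V, (∏ s, p (z s)) * Real.log (L z) ≤ κ * commonCount I x p j := by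
    rw [hL, sum_prod_mul_log hI x hp1 (fun v => (div_pos (hq v) (hp v)).ne'), ← neg_mul]
    refine mul_le_mul_of_nonneg_right hκ
      (Finset.sum_nonneg fun t _ => Finset.sum_nonneg fun z _ => ?_)
    exact mul_nonneg (hP z) (by split_ifs <;> norm_num)
  have hmax : ∑ z : Fin T → V, (∏ s, p (z s)) * max (1 - L z) 0 ≤
      c / 2 + κ * commonCount I x p j / c := by
    calc ∑ z : Fin T → V, (∏ s, p (z s)) * max (1 - L z) 0
        ≤ ∑ z : Fin T → V, (∏ s, p (z s)) * (c / 2 + (L z - 1 - Real.log (L z)) / c) :=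
          Finset.sum_le_sum fun z _ =>
            mul_le_mul_of_nonneg_left (one_sub_le_of_pos (hLpos z) hc) (hP z)
      _ = c / 2 * ∑ z : Fin T → V, ∏ s, p (z s) + (∑ z : Fin T → V, (∏ s, p (z s)) * L z -
            ∑ z : Fin T → V, ∏ s, p (z s) -
            ∑ z : Fin T → V, (∏ s, p (z s)) * Real.log (L z)) / c := by
          rw [← Finset.sum_sub_distrib, ← Finset.sum_sub_distrib, Finset.sum_div, Finset.mul_sum,
            ← Finset.sum_add_distrib]
          exact Finset.sum_congr rfl fun z _ => by ring
      _ ≤ c / 2 + κ * commonCount I x p j / c := by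
          rw [hL1, sum_prod_eq_one hp1]
          have : (1 - 1 - ∑ z : Fin T → V, (∏ s, p (z s)) * Real.log (L z)) / c ≤
              κ * commonCount I x p j / c := by
            gcongr
            linarith
          linarith
  rw [change, sub_le_iff_le_add, ← sub_le_iff_le_add', ← Finset.sum_sub_distrib]
  refine le_trans (Finset.sum_le_sum fun z _ => ?_) hmax
  have h1 := hf (I (commonLosses K x z))
  have : (1 - L z) * f (I (commonLosses K x z)) ≤ max (1 - L z) 0 :=
    calc (1 - L z) * f (I (commonLosses K x z))
        ≤ max (1 - L z) 0 * f (I (commonLosses K x z)) :=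
          mul_le_mul_of_nonneg_right (le_max_left _ _) h1.1
      _ ≤ max (1 - L z) 0 * 1 := mul_le_mul_of_nonneg_left h1.2 (le_max_right _ _)
      _ = _ := mul_one _
  have := mul_le_mul_of_nonneg_left this (hP z)
  linarith

/-- A lower bound on the summed excess loss over the distinguished arm. -/
theorem sum_sum_prod_mul_excess_ge [DecidableEq V]
    {I : (Fin T → Fin K → ℝ) → Fin T → Fin K}
    (hI : IsNonanticipating I) (x : V → ℝ) {X Y : W → V} {r : W → ℝ} {p q : V → ℝ}
    (hX : ∀ v, (∑ w, if X w = v then r w else 0) = p v)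
    (hY : ∀ v, (∑ w, if Y w = v then r w else 0) = q v)
    (hp : ∀ v, 0 < p v) (hq : ∀ v, 0 < q v) (hp1 : ∑ v, p v = 1) (hr1 : ∑ w, r w = 1)
    {c κ : ℝ} (hc : 0 < c) (hκ : -∑ v, p v * Real.log (q v / p v) ≤ κ)
    (hδ : 0 ≤ ∑ w, r w * (x (X w) - x (Y w))) :
    (∑ w, r w * (x (X w) - x (Y w))) * (T * (K - 1 - (K * c / 2 + κ * T / c))) ≤
      ∑ j : Fin K, ∑ w : Fin T → W, (∏ t, r (w t)) *
        ∑ t, (coupledLosses x X Y j w t (I (coupledLosses x X Y j w) t) -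
          coupledLosses x X Y j w t j) := by
  have play : ∀ (j : Fin K) (t : Fin T),
      ∑ w : Fin T → W, (∏ s, r (w s)) *
        (coupledLosses x X Y j w t (I (coupledLosses x X Y j w) t) - coupledLosses x X Y j w t j) =
      (∑ w, r w * (x (X w) - x (Y w))) * ∑ w : Fin T → W, (∏ s, r (w s)) *
        if I (coupledLosses x X Y j w) t = j then 0 else 1 := fun j t => by
    rw [← sum_prod_mul_of_update_eq hr1 t
      (f := fun w => if I (coupledLosses x X Y j w) t = j then 0 else 1)
      (fun w v => by simp only [hI.update_coupled])]
    refine Finset.sum_congr rfl fun w _ => ?_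
    by_cases h : I (coupledLosses x X Y j w) t = j <;> simp [h, coupledLosses]
  have bound : ∀ (j : Fin K) (t : Fin T),
      1 - ∑ z : Fin T → V, (∏ s, p (z s)) * (if I (commonLosses K x z) t = j then 1 else 0) -
        (c / 2 + κ * commonCount I x p j / c) ≤
      ∑ w : Fin T → W, (∏ s, r (w s)) *
        if I (coupledLosses x X Y j w) t = j then 0 else 1 := fun j t => by
    have total : ∑ z : Fin T → V, (∏ s, p (z s)) *
          (if I (commonLosses K x z) t = j then (1 : ℝ) else 0) +
        ∑ z : Fin T → V, (∏ s, p (z s)) *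
          (if I (commonLosses K x z) t = j then (0 : ℝ) else 1) = 1 := by
      rw [← Finset.sum_add_distrib]
      refine Eq.trans (Finset.sum_congr rfl fun z _ => ?_) (sum_prod_eq_one (ι := Fin T) hp1)
      split_ifs <;> simp
    have := sum_prod_mul_coupledLosses_ge hI x hX hY j hp hq hp1 hr1 hc hκ
      (f := fun a => if a t = j then 0 else 1) fun a => by split_ifs <;> simp
    linarith
  calc (∑ w, r w * (x (X w) - x (Y w))) * (T * (K - 1 - (K * c / 2 + κ * T / c)))
      = (∑ w, r w * (x (X w) - x (Y w))) * ∑ j : Fin K, ∑ t : Fin T,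
        (1 - ∑ z : Fin T → V, (∏ s, p (z s)) * (if I (commonLosses K x z) t = j then 1 else 0) -
          (c / 2 + κ * commonCount I x p j / c)) := by
        congr 1
        -- With the same `c` for every arm the bound is affine in `commonCount`, so only the total
        -- `T` of the counts enters and no Cauchy-Schwarz step is needed.
        have h : ∀ j : Fin K, ∑ t : Fin T,
            (1 - ∑ z : Fin T → V, (∏ s, p (z s)) *
                (if I (commonLosses K x z) t = j then 1 else 0) -
              (c / 2 + κ * commonCount I x p j / c)) =
            T * (1 - c / 2) - (1 + T * κ / c) * commonCount I x p j := fun j => by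
          rw [Finset.sum_sub_distrib, Finset.sum_sub_distrib, ← commonCount]
          simp only [Finset.sum_const, Finset.card_univ, Fintype.card_fin, nsmul_eq_mul]
          ring
        simp only [h]
        rw [Finset.sum_sub_distrib, ← Finset.mul_sum (f := commonCount I x p),
          sum_commonCount I x hp1]
        simp only [Finset.sum_const, Finset.card_univ, Fintype.card_fin, nsmul_eq_mul]
        ring
    _ ≤ _ := by
        rw [Finset.mul_sum]
        refine Finset.sum_le_sum fun j _ => ?_
        simp only [Finset.mul_sum (Finset.univ : Finset (Fin T))]
        rw [Finset.sum_comm]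
        refine Finset.sum_le_sum fun t _ => ?_
        rw [play]
        exact mul_le_mul_of_nonneg_left (bound j t) hδ

end SharedNoise

/-! ### The grid law with one hidden downward step. -/

/-- The joint law of a uniform grid point `k` and of the event that the distinguished arm is moved
one grid point down, which has conditional probability `k (N - k) / N ^ 2`. -/
noncomputable def stepLaw (N : ℕ) (w : Fin N × Bool) : ℝ :=
  (if w.2 then (w.1 : ℝ) * (N - w.1) / N ^ 2 else 1 - (w.1 : ℝ) * (N - w.1) / N ^ 2) / N

/-- The grid point of the distinguished arm. -/
def steppedPoint {N : ℕ} (w : Fin N × Bool) : Fin N :=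
  ⟨w.1 - w.2.toNat, (Nat.sub_le _ _).trans_lt w.1.isLt⟩

/-- The law of `steppedPoint` under `stepLaw`. -/
noncomputable def tiltedLaw (N : ℕ) (v : Fin N) : ℝ := (1 + ((N : ℝ) - 1 - 2 * v) / N ^ 2) / N

theorem stepLaw_nonneg {N : ℕ} (w : Fin N × Bool) : 0 ≤ stepLaw N w := by
  have h1 : (w.1 : ℝ) ≤ N := by exact_mod_cast w.1.isLt.le
  have h0 : (0 : ℝ) ≤ w.1 := Nat.cast_nonneg _
  have h2 : (w.1 : ℝ) * (N - w.1) ≤ N ^ 2 := by nlinarith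
  unfold stepLaw
  refine div_nonneg ?_ (Nat.cast_nonneg _)
  split_ifs
  · exact div_nonneg (mul_nonneg h0 (by linarith)) (by positivity)
  · exact sub_nonneg.2 (div_le_one_of_le₀ h2 (by positivity))

theorem sum_stepLaw_fst {N : ℕ} (v : Fin N) :
    (∑ w : Fin N × Bool, if w.1 = v then stepLaw N w else 0) = 1 / N := by
  simp only [Fintype.sum_prod_type, Fintype.sum_bool, stepLaw]
  rw [Finset.sum_eq_single v (fun k _ hk => by simp [hk]) (by simp)]
  simp only [if_true, Bool.false_eq_true, if_false]
  ring

/-- Mass `(v + 1) (N - v - 1) / N ^ 3` enters `v` from above and `v (N - v) / N ^ 3` leaves it. The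
step probability tapers off at both ends of the grid, which keeps the relative change of mass below
`1 / N` there too; a constant probability would change the end masses by a constant factor. -/
theorem sum_stepLaw_steppedPoint {N : ℕ} (v : Fin N) :
    (∑ w : Fin N × Bool, if steppedPoint w = v then stepLaw N w else 0) = tiltedLaw N v := by
  have hN : (N : ℝ) ≠ 0 := Nat.cast_ne_zero.2 (Nat.ne_zero_of_lt v.isLt)
  simp only [Fintype.sum_prod_type, Fintype.sum_bool, stepLaw, steppedPoint, Fin.ext_iff,
    Bool.toNat_true, Bool.toNat_false, if_true, Bool.false_eq_true, if_false,
    Finset.sum_add_distrib, Nat.sub_zero]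
  -- Truncation makes `k = 0` satisfy `k - 1 = 0`, and `v = N - 1` would need `k = N`; both terms
  -- have weight zero, so the sum may be extended and shifted.
  have h2 : (∑ k : Fin N, if (k : ℕ) - 1 = v then (k : ℝ) * (N - k) / N ^ 2 / N else 0) =
      ((v : ℝ) + 1) * (N - (v + 1)) / N ^ 2 / N := by
    rw [Fin.sum_univ_eq_sum_range
      (fun k => if k - 1 = (v : ℕ) then (k : ℝ) * (N - k) / N ^ 2 / N else 0) N]
    have e := Finset.sum_range_succ
      (fun k : ℕ => if k - 1 = (v : ℕ) then (k : ℝ) * (N - k) / N ^ 2 / N else 0) N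
    rw [Finset.sum_range_succ'] at e
    simp only [sub_self, mul_zero, zero_div, ite_self, add_zero, Nat.cast_zero, zero_mul,
      Nat.add_sub_cancel] at e
    rw [← e, Finset.sum_ite_eq' (Finset.range N) (v : ℕ), if_pos (Finset.mem_range.2 v.isLt)]
    push_cast
    ring
  rw [h2]
  simp only [← Fin.ext_iff, Finset.sum_ite_eq', Finset.mem_univ, if_true, tiltedLaw]
  field_simp
  ring

theorem sum_stepLaw {N : ℕ} (hN : 0 < N) : ∑ w, stepLaw N w = 1 := by
  have : (N : ℝ) ≠ 0 := Nat.cast_ne_zero.2 hN.ne'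
  calc ∑ w, stepLaw N w = ∑ v : Fin N, ∑ w : Fin N × Bool, if w.1 = v then stepLaw N w else 0 := by
        rw [Finset.sum_comm]
        simp
    _ = 1 := by simp [sum_stepLaw_fst, this]

theorem sum_range_mul_sub (a : ℝ) (n : ℕ) : ∑ k ∈ Finset.range n, (k : ℝ) * (a - k) =
    a * n * (n - 1) / 2 - (n - 1) * n * (2 * n - 1) / 6 := by
  induction n with
  | zero => simp
  | succ n ih =>
    rw [Finset.sum_range_succ, ih]
    push_cast
    ring

theorem sum_stepLaw_mul_sub {N : ℕ} (hN : 0 < N) :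
    ∑ w, stepLaw N w * ((w.1 : ℝ) / N - (steppedPoint w : ℝ) / N) =
      ((N : ℝ) ^ 2 - 1) / (6 * N ^ 3) := by
  have hN0 : (N : ℝ) ≠ 0 := Nat.cast_ne_zero.2 hN.ne'
  have h : ∀ k : Fin N, (k : ℝ) * (N - k) / N ^ 2 / N *
      ((k : ℝ) / N - ((k - 1 : ℕ) : ℝ) / N) = (k : ℝ) * (N - k) * (1 / N ^ 4) := fun k => by
    rcases Nat.eq_zero_or_pos (k : ℕ) with h0 | h0
    · simp [h0]
    · rw [Nat.cast_sub h0]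
      field_simp
      push_cast
      ring
  simp only [Fintype.sum_prod_type, Fintype.sum_bool, stepLaw, steppedPoint,
    Bool.toNat_true, Bool.toNat_false, if_true, Bool.false_eq_true, if_false,
    Nat.sub_zero, sub_self, mul_zero, add_zero, h]
  rw [← Finset.sum_mul, Fin.sum_univ_eq_sum_range (fun k => (k : ℝ) * (N - k)) N,
    sum_range_mul_sub]
  field_simp
  ring

theorem abs_tilt_le {N : ℕ} (v : Fin N) : |((N : ℝ) - 1 - 2 * v) / N ^ 2| ≤ 1 / (N : ℝ) := by
  have hN : (0 : ℝ) < N := Nat.cast_pos.2 (Nat.zero_lt_of_lt v.isLt)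
  have h1 : (v : ℝ) + 1 ≤ N := by exact_mod_cast v.isLt
  have h0 : (0 : ℝ) ≤ v := Nat.cast_nonneg _
  rw [abs_div, abs_of_pos (by positivity : (0 : ℝ) < N ^ 2), div_le_div_iff₀ (by positivity) hN]
  have : |(N : ℝ) - 1 - 2 * v| ≤ N := abs_le.2 ⟨by linarith, by linarith⟩
  nlinarith

theorem one_add_tilt_ge {N : ℕ} (hN : 5 ≤ N) (v : Fin N) :
    4 / 5 ≤ 1 + ((N : ℝ) - 1 - 2 * v) / N ^ 2 := by
  have h5 : (5 : ℝ) ≤ N := by exact_mod_cast hN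
  have h := (abs_le.1 (abs_tilt_le v)).1
  have : 1 / (N : ℝ) ≤ 1 / 5 := one_div_le_one_div_of_le (by norm_num) h5
  linarith

theorem tiltedLaw_pos {N : ℕ} (hN : 5 ≤ N) (v : Fin N) : 0 < tiltedLaw N v :=
  div_pos (by linarith [one_add_tilt_ge hN v]) (Nat.cast_pos.2 (by omega))

theorem neg_log_one_add_le {u : ℝ} (hu : 4 / 5 ≤ 1 + u) :
    -Real.log (1 + u) ≤ -u + 5 / 4 * u ^ 2 := by
  have h := Real.one_sub_inv_le_log_of_pos (show 0 < 1 + u by linarith)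
  have e : 1 - (1 + u)⁻¹ = u - u ^ 2 / (1 + u) := by
    have : 1 + u ≠ 0 := by linarith
    field_simp
    ring
  have h2 : u ^ 2 / (1 + u) ≤ u ^ 2 / (4 / 5) := by gcongr
  linarith

/-- The relative entropy of the uniform law with respect to the tilted law. -/
theorem relEntropy_tiltedLaw_le {N : ℕ} (hN : 5 ≤ N) :
    -∑ v : Fin N, 1 / (N : ℝ) * Real.log (tiltedLaw N v / (1 / N)) ≤ 5 / 4 * (1 / N ^ 2) := by
  have hN0 : (0 : ℝ) < N := Nat.cast_pos.2 (by omega)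
  have hsum : ∑ v : Fin N, ((N : ℝ) - 1 - 2 * v) / N ^ 2 = 0 := by
    rw [← Finset.sum_div, Fin.sum_univ_eq_sum_range (fun k => (N : ℝ) - 1 - 2 * k) N]
    have : ∀ n : ℕ, ∑ k ∈ Finset.range n, ((N : ℝ) - 1 - 2 * k) = n * (N - n) := fun n => by
      induction n with
      | zero => simp
      | succ n ih =>
        rw [Finset.sum_range_succ, ih]
        push_cast
        ring
    simp [this]
  have hv : ∀ v : Fin N, -Real.log (tiltedLaw N v / (1 / N)) ≤
      -(((N : ℝ) - 1 - 2 * v) / N ^ 2) + 5 / 4 * (1 / N ^ 2) := fun v => by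
    have e : tiltedLaw N v / (1 / N) = 1 + ((N : ℝ) - 1 - 2 * v) / N ^ 2 := by
      unfold tiltedLaw
      field_simp
    rw [e]
    refine (neg_log_one_add_le (one_add_tilt_ge hN v)).trans ?_
    have h := pow_le_pow_left₀ (abs_nonneg _) (abs_tilt_le v) 2
    rw [sq_abs, div_pow 1, one_pow] at h
    linarith
  rw [← Finset.mul_sum, ← mul_neg, ← Finset.sum_neg_distrib]
  calc 1 / (N : ℝ) * ∑ v : Fin N, -Real.log (tiltedLaw N v / (1 / N))
      ≤ 1 / (N : ℝ) * ∑ v : Fin N,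
        (-(((N : ℝ) - 1 - 2 * v) / N ^ 2) + 5 / 4 * (1 / N ^ 2)) :=
        mul_le_mul_of_nonneg_left (Finset.sum_le_sum fun v _ => hv v) (by positivity)
    _ = 5 / 4 * (1 / N ^ 2) := by
        rw [Finset.sum_add_distrib, Finset.sum_neg_distrib, hsum]
        simp only [Finset.sum_const, Finset.card_univ, Fintype.card_fin, nsmul_eq_mul]
        field_simp
        ring

theorem coupledLosses_mem_lossesOfRange {K T N : ℕ} {ρ : ℝ} (hN : 0 < N) (hρ : 1 / (N : ℝ) ≤ ρ)
    (j : Fin K) (w : Fin T → Fin N × Bool) (t : Fin T) :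
    coupledLosses (fun v : Fin N => (v : ℝ) / N) Prod.fst steppedPoint j w t ∈
      lossesOfRange K ρ := by
  have hN0 : (0 : ℝ) < N := Nat.cast_pos.2 hN
  have hρ0 : 0 ≤ ρ := le_trans (by positivity) hρ
  have hstep : |((w t).1 : ℝ) / N - (steppedPoint (w t) : ℝ) / N| ≤ ρ := by
    refine le_trans ?_ hρ
    rw [← sub_div, abs_div, abs_of_pos hN0]
    gcongr
    have h1 : (steppedPoint (w t) : ℕ) ≤ (w t).1 := Nat.sub_le _ _
    have h2 : ((w t).1 : ℕ) ≤ (steppedPoint (w t) : ℕ) + 1 := by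
      have := Bool.toNat_le (w t).2
      simp only [steppedPoint]
      omega
    have h1' : (steppedPoint (w t) : ℝ) ≤ (w t).1 := by exact_mod_cast h1
    have h2' : ((w t).1 : ℝ) ≤ (steppedPoint (w t) : ℝ) + 1 := by exact_mod_cast h2
    exact abs_le.2 ⟨by linarith, by linarith⟩
  refine ⟨fun i => ⟨by unfold coupledLosses; positivity, ?_⟩, fun i k => ?_⟩
  · refine div_le_one_of_le₀ ?_ hN0.le
    exact_mod_cast (Fin.is_lt _).le
  · unfold coupledLosses
    dsimp only
    split_ifs
    · simpa using hρ0
    · rw [abs_sub_comm]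
      exact hstep
    · exact hstep
    · simpa using hρ0

/-! ### Choice of the grid and conclusion. -/

theorem exists_grid {K T : ℕ} (hK : 2 ≤ K) (hT : 32 * ((K : ℝ) - 1) * Real.log 14 ≤ (T : ℝ)) :
    ∃ N : ℕ, 5 ≤ N ∧ 1 / (N : ℝ) ≤ 0.22 * Real.sqrt (((K : ℝ) - 1) / T) ∧
      Real.sqrt ((T : ℝ) * (K - 1)) / 504 ≤ 1 / K * (((N : ℝ) ^ 2 - 1) / (6 * N ^ 3) *
        (T * (K - 1 - (K * (1 / 3) / 2 + 5 / 4 * (1 / N ^ 2) * T / (1 / 3))))) := by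
  have hK2 : (2 : ℝ) ≤ K := by exact_mod_cast hK
  -- The hypothesis on `T` serves only through `T ≥ 32 (K - 1)`, which gives `s ≥ 5` below.
  have hlog : 1 ≤ Real.log 14 := by
    rw [Real.le_log_iff_exp_le (by norm_num)]
    linarith [Real.exp_one_lt_d9]
  have hT32 : 32 * ((K : ℝ) - 1) ≤ T := by nlinarith
  have hk : (0 : ℝ) < K - 1 := by linarith
  have hT0 : (0 : ℝ) < T := by linarith
  obtain ⟨s, hs, hs0, hTs⟩ : ∃ s : ℝ, s = Real.sqrt (T / (K - 1)) ∧ 5 ≤ s ∧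
      (T : ℝ) = s ^ 2 * (K - 1) := by
    refine ⟨_, rfl, Real.le_sqrt_of_sq_le ?_, ?_⟩
    · rw [le_div_iff₀ hk]
      linarith
    · rw [Real.sq_sqrt (by positivity)]
      field_simp
  have hinv : Real.sqrt (((K : ℝ) - 1) / T) = 1 / s := by
    rw [hs, one_div, ← Real.sqrt_inv, inv_div]
  have hmul : Real.sqrt ((T : ℝ) * (K - 1)) = s * (K - 1) := by
    rw [hTs, show s ^ 2 * ((K : ℝ) - 1) * (K - 1) = (s * (K - 1)) ^ 2 by ring]
    exact Real.sqrt_sq (by positivity)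
  -- The coarsest grid whose mesh is at most `0.22 / s`; as `1 / 0.22 < 4.55`, rounding up still
  -- leaves `N ≤ 5 s`.
  obtain ⟨N, hN1, hN2⟩ : ∃ N : ℕ, s / 0.22 ≤ N ∧ (N : ℝ) ≤ 5 * s := by
    refine ⟨⌈s / 0.22⌉₊, Nat.le_ceil _, (Nat.ceil_lt_add_one (by positivity)).le.trans ?_⟩
    norm_num
    linarith
  have hsN : s ≤ 0.22 * N := by
    rw [div_le_iff₀ (by norm_num)] at hN1
    linarith
  have h5 : (5 : ℝ) ≤ N := by
    norm_num at hsN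
    linarith
  have hN0 : (0 : ℝ) < N := by linarith
  refine ⟨N, by exact_mod_cast h5, ?_, ?_⟩
  · rw [hinv, mul_one_div, div_le_div_iff₀ hN0 (by linarith)]
    linarith
  · have hκ : 5 / 4 * (1 / (N : ℝ) ^ 2) * T / (1 / 3) ≤ 0.1815 * (K - 1) := by
      have : (T : ℝ) / N ^ 2 ≤ 0.0484 * (K - 1) := by
        rw [div_le_iff₀ (by positivity), hTs]
        have : s ^ 2 ≤ 0.0484 * (N : ℝ) ^ 2 := by
          calc s ^ 2 ≤ (0.22 * N) ^ 2 := pow_le_pow_left₀ (by linarith) hsN 2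
            _ = 0.0484 * (N : ℝ) ^ 2 := by ring
        nlinarith
      calc 5 / 4 * (1 / (N : ℝ) ^ 2) * T / (1 / 3) = 15 / 4 * ((T : ℝ) / N ^ 2) := by ring
        _ ≤ 15 / 4 * (0.0484 * ((K : ℝ) - 1)) := by gcongr
        _ = 0.1815 * ((K : ℝ) - 1) := by ring
    -- Here `K ≥ 2` enters as `K - 1 ≥ K / 2`: `0.8185 / 2 - 1 / 6 > 6 / 25`.
    have hgap : (K : ℝ) * (6 / 25) ≤
        K - 1 - (K * (1 / 3) / 2 + 5 / 4 * (1 / N ^ 2) * T / (1 / 3)) := by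
      norm_num at hκ ⊢
      linarith
    have hdrop : 1 / (50 * s) ≤ ((N : ℝ) ^ 2 - 1) / (6 * N ^ 3) := by
      calc 1 / (50 * s) ≤ 1 / (10 * N) := one_div_le_one_div_of_le (by positivity) (by linarith)
        _ ≤ ((N : ℝ) ^ 2 - 1) / (6 * N ^ 3) := by
          rw [div_le_div_iff₀ (by positivity) (by positivity)]
          nlinarith [mul_le_mul h5 h5 (by norm_num) hN0.le]
    have hdrop0 : 0 < 1 / (50 * s) := by positivity
    calc Real.sqrt ((T : ℝ) * (K - 1)) / 504 ≤ 1 / K * (1 / (50 * s) * (T * (K * (6 / 25)))) := by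
          rw [hmul, hTs]
          have : 1 / (K : ℝ) * (1 / (50 * s) * (s ^ 2 * (K - 1) * (K * (6 / 25)))) =
              s * (K - 1) * (6 / 1250) := by
            have : s ≠ 0 := by linarith
            have : (K : ℝ) ≠ 0 := by linarith
            field_simp
            ring
          rw [this]
          have : 0 ≤ s * ((K : ℝ) - 1) := by positivity
          linarith
      _ ≤ _ := by
          have := hdrop0.le.trans hdrop
          gcongr

theorem exists_losses_le_expectedRegret (K T : ℕ) (ρ : ℝ) (hK : 2 ≤ K)
    (hT : 32 * ((K : ℝ) - 1) * Real.log 14 ≤ (T : ℝ))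
    (hρ : 0.22 * Real.sqrt (((K : ℝ) - 1) / (T : ℝ)) ≤ ρ)
    {Ω : Type*} [MeasurableSpace Ω] (P : Measure Ω) [IsProbabilityMeasure P]
    (A : BanditAlgorithm K T Ω) :
    ∃ ℓ : Fin T → Fin K → ℝ, (∀ t, ℓ t ∈ lossesOfRange K ρ) ∧
      Real.sqrt ((T : ℝ) * ((K : ℝ) - 1)) / 504 ≤ A.expectedRegret P ℓ := by
  obtain ⟨N, hN5, hNρ, hbound⟩ := exists_grid hK hT
  have hN : 0 < N := by omega
  have hN0 : (N : ℝ) ≠ 0 := Nat.cast_ne_zero.2 hN.ne'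
  have hK0 : (K : ℝ) ≠ 0 := Nat.cast_ne_zero.2 (by omega)
  let ℓ : Fin K × (Fin T → Fin N × Bool) → Fin T → Fin K → ℝ := fun i =>
    coupledLosses (fun v : Fin N => (v : ℝ) / N) Prod.fst steppedPoint i.1 i.2
  have hℓ : ∀ i t, ℓ i t ∈ lossesOfRange K ρ := fun i t =>
    coupledLosses_mem_lossesOfRange hN (hNρ.trans hρ) i.1 i.2 t
  have hm1 : ∑ i : Fin K × (Fin T → Fin N × Bool), 1 / (K : ℝ) * ∏ t, stepLaw N (i.2 t) = 1 := by
    rw [← Finset.mul_sum, Fintype.sum_prod_type]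
    simp [sum_prod_eq_one (sum_stepLaw hN), hK0]
  obtain ⟨i, hi⟩ := A.exists_le_expectedRegret P
    (m := fun i : Fin K × (Fin T → Fin N × Bool) => 1 / (K : ℝ) * ∏ t, stepLaw N (i.2 t))
    (fun i => mul_nonneg (by positivity) (Finset.prod_nonneg fun t _ => stepLaw_nonneg _)) hm1
    (ℓ := ℓ) (fun i t => (hℓ i t).1) (by omega) fun ω => by
      refine hbound.trans ?_
      have hdrop := sum_stepLaw_mul_sub hN
      have key := sum_sum_prod_mul_excess_ge (A.isNonanticipating_action ω)
        (fun v : Fin N => (v : ℝ) / N) (r := stepLaw N) sum_stepLaw_fst sum_stepLaw_steppedPoint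
        (fun _ => by positivity) (tiltedLaw_pos hN5) (by simp [hN0]) (sum_stepLaw hN)
        (c := 1 / 3) (by norm_num) (relEntropy_tiltedLaw_le hN5) (by
          rw [hdrop]
          have : (1 : ℝ) ≤ N := by exact_mod_cast hN
          refine div_nonneg ?_ (by positivity)
          nlinarith)
      rw [hdrop] at key
      simp only [mul_assoc (1 / (K : ℝ))]
      rw [← Finset.mul_sum, Fintype.sum_prod_type]
      refine mul_le_mul_of_nonneg_left (key.trans ?_) (by positivity)
      refine Finset.sum_le_sum fun j _ => Finset.sum_le_sum fun w _ => ?_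
      refine mul_le_mul_of_nonneg_left ?_ (Finset.prod_nonneg fun t _ => stepLaw_nonneg _)
      -- Regret dominates the excess over arm `j`, since the best arm does at least as well as `j`.
      rw [Finset.sum_sub_distrib]
      exact sub_le_sub_left
        (ciInf_le (f := fun k => ∑ t, ℓ (j, w) t k) (Set.finite_range _).bddBelow j) _
  exact ⟨ℓ i, hℓ i, hi⟩

theorem corollary4 (K T : ℕ) (ρ : ℝ) (hK : 2 ≤ K)
    (hT : 32 * ((K : ℝ) - 1) * Real.log 14 ≤ (T : ℝ))
    (hρ : 0.22 * Real.sqrt (((K : ℝ) - 1) / (T : ℝ)) ≤ ρ)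
    {Ω : Type*} [MeasurableSpace Ω] (P : Measure Ω) [IsProbabilityMeasure P]
    (A : BanditAlgorithm K T Ω) :
    (∃ ℓ : Fin T → Fin K → ℝ, (∀ t, ℓ t ∈ lossesOfRange K ρ) ∧
      Real.sqrt ((T : ℝ) * ((K : ℝ) - 1)) / 504 ≤ A.expectedRegret P ℓ) ∧
    Real.sqrt ((T : ℝ) * ((K : ℝ) - 1)) / 504 ≤
      ⨆ ℓ : {ℓ : Fin T → Fin K → ℝ // ∀ t, ℓ t ∈ lossesOfRange K ρ},
        A.expectedRegret P ℓ.1 := by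
  obtain ⟨ℓ, hℓ, h⟩ := exists_losses_le_expectedRegret K T ρ hK hT hρ P A
  refine ⟨⟨ℓ, hℓ, h⟩, h.trans ?_⟩
  -- A real supremum defaults to zero when unbounded, so the upper bound `T` is required.
  refine le_ciSup (f := fun ℓ : {ℓ : Fin T → Fin K → ℝ // ∀ t, ℓ t ∈ lossesOfRange K ρ} =>
    A.expectedRegret P ℓ.1) ⟨T, ?_⟩ ⟨ℓ, hℓ⟩
  rintro _ ⟨ℓ', rfl⟩
  exact A.expectedRegret_le P (fun t => (ℓ'.2 t).1) (by omega)
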